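/- Let $Q_6$ be the $6$-dimensional hypercube graph, with vertex set $\{0,1\}^6$ and an edge between two vertices exactly when they differ in exactly one coordinate. A bond percolation model on a graph $G$ is a probability distribution on the spanning subgraphs of $G$; an edge is open if it is present in the random subgraph and closed otherwise. The model is 1-independent if, for any two sets $S_1,S_2$ of edges of $G$ such that no edge of $S_1$ shares a vertex with an edge of $S_2$, the states (open or closed) of the edges in $S_1$ are independent of the states of the edges in $S_2$. Let $\mathcal{D}_{\ge p}(G)$ be the class of 1-independent bond percolation models on $G$ in which each edge is open with probability at least $p$, and let $\varphi=\frac12(1+\sqrt5)$ be the golden ratio. Lemma 1.5. There exists a constant $P>(1-0.5847)^{32}\varphi$ such that, in every model in $\mathcal{D}_{\ge 0.5847}(Q_6)$, the probability that the random spanning subgraph is connected is at least $P$. -/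

import Mathlib

open MeasureTheory ProbabilityTheory

/-- The hypercube graph `Q_n`: the vertex set is `{0,1}^n`, and two vertices are adjacent if they
differ in exactly one coordinate. -/
def hypercube (n : ℕ) : SimpleGraph (Fin n → Bool) where
  Adj x y := hammingDist x y = 1
  symm := ⟨fun x y h => by rwa [hammingDist_comm]⟩
  loopless := ⟨fun x h => by simp at h⟩

/-- A bond configuration on `G`: each edge is open (`true`) or closed (`false`). It carries the
product measurable space, and amounts to a spanning subgraph of `G`. -/
abbrev BondConfig {V : Type*} (G : SimpleGraph V) : Type _ := G.edgeSet → Bool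

/-- The spanning subgraph of `G` formed by all vertices and the open edges. -/
def openSubgraph {V : Type*} {G : SimpleGraph V} (ω : BondConfig G) : SimpleGraph V :=
  SimpleGraph.fromEdgeSet {e | ∃ h : e ∈ G.edgeSet, ω ⟨e, h⟩ = true}

/-- No edge in `S` shares a vertex with an edge in `T` (in particular `S` and `T` are disjoint). -/
def VertexDisjoint {V : Type*} {G : SimpleGraph V} (S T : Set G.edgeSet) : Prop :=
  ∀ e ∈ S, ∀ f ∈ T, ∀ v : V, v ∈ (e : Sym2 V) → v ∉ (f : Sym2 V)

/-- A law on bond configurations is 1-independent if the states of the edges in `S` are independent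
of the states of the edges in `T` whenever no edge in `S` shares a vertex with an edge in `T`. -/
def OneIndependent {V : Type*} {G : SimpleGraph V} (μ : Measure (BondConfig G)) : Prop :=
  ∀ S T : Set G.edgeSet, VertexDisjoint S T →
    IndepFun (fun (ω : BondConfig G) (e : S) => ω e) (fun (ω : BondConfig G) (e : T) => ω e) μ

/-- The class `𝒟_{≥ p}(G)` of 1-independent bond percolation models on `G` (probability measures on
bond configurations) in which each edge is open with probability at least `p`. -/
def oneIndepModels {V : Type*} (G : SimpleGraph V) (p : ℝ) : Set (Measure (BondConfig G)) :=
  {μ | IsProbabilityMeasure μ ∧ OneIndependent μ ∧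
    ∀ e : G.edgeSet, p ≤ μ.real {ω | ω e = true}}

/-! View `Q_6` as `Q_3 × Q_3`: eight fibres, each a copy of `Q_3`, placed at the vertices of another
`Q_3`. The configuration is connected if every fibre is internally connected and the fibres are
joined by open edges along a connected spanning subgraph of the outer cube.

Distinct fibres share no vertex, so all are connected with probability at least `0.04628 ^ 8`. Two
adjacent fibres are joined by eight vertex-disjoint edges, which all fail with probability at most
`0.4153 ^ 8`; conditioning on both fibres being connected raises this to at most `0.4153 ^ 8 /
0.04628 ^ 2 < 1 - 0.5868`. Under conditioning on all fibres, the outer cube still has each edge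
independent of the edges disjoint from it (`isCubeModel_cross`), now with edge probability at least
`0.5868`, and is connected with probability at least `0.0475`.

Both cube bounds, `0.04628` at `p = 0.5847` and `0.0475` at `p = 0.5868`, come from linear
programming duality (`IsCubeModel.mul_le_connInd`). If edge `i` has probability exactly `p` and `g
i` depends only on edges disjoint from `i`, then `g i * (edgeInd i - p)` has mean zero. So a
pointwise bound of the sum of these terms plus `α` by the connection indicator gives connection
probability at least `α`. The bound is checked on all `2 ^ 12` configurations. -/

/-- The edges of the 3-dimensional cube on `Fin 8`, whose vertices are read as binary numbers. -/
def cubeEdge : Fin 12 → Fin 8 × Fin 8 :=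
  ![(0, 1), (2, 3), (4, 5), (6, 7), (0, 2), (4, 6), (1, 3), (5, 7), (0, 4), (1, 5), (2, 6), (3, 7)]

/-- The spanning subgraph of the 3-dimensional cube with edges `cubeEdge i` for `c i = true`. -/
def cubeGraph (c : Fin 12 → Bool) : SimpleGraph (Fin 8) :=
  SimpleGraph.fromRel fun u v => ∃ i, c i = true ∧ cubeEdge i = (u, v)

/-- The edges of the cube sharing no vertex with the `i`-th edge. -/
def farEdges (i : Fin 12) : Set (Fin 12) :=
  {j | (cubeEdge i).1 ≠ (cubeEdge j).1 ∧ (cubeEdge i).1 ≠ (cubeEdge j).2 ∧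
    (cubeEdge i).2 ≠ (cubeEdge j).1 ∧ (cubeEdge i).2 ≠ (cubeEdge j).2}

/-- Indicator that the `i`-th edge is open. -/
def edgeInd (i : Fin 12) (c : Fin 12 → Bool) : ℝ := if c i = true then 1 else 0

open Classical in
/-- Indicator that the open subgraph of the cube is connected. -/
noncomputable def connInd (c : Fin 12 → Bool) : ℝ := if (cubeGraph c).Connected then 1 else 0

/-- Close the `i`-th edge. -/
def closeEdge (i : Fin 12) (c : Fin 12 → Bool) : Fin 12 → Bool := Function.update c i false

lemma cubeGraph_mono {c c' : Fin 12 → Bool} (h : ∀ i, c i = true → c' i = true) :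
    cubeGraph c ≤ cubeGraph c' := by
  intro u v huv
  simp only [cubeGraph, SimpleGraph.fromRel_adj] at huv ⊢
  refine ⟨huv.1, huv.2.imp ?_ ?_⟩ <;> exact fun ⟨i, hi, he⟩ => ⟨i, h i hi, he⟩

lemma connInd_nonneg (c : Fin 12 → Bool) : 0 ≤ connInd c := by
  unfold connInd; split_ifs <;> norm_num

lemma connInd_closeEdge_le (i : Fin 12) (c : Fin 12 → Bool) :
    connInd (closeEdge i c) ≤ connInd c := by
  by_cases h : (cubeGraph (closeEdge i c)).Connected
  · have h' : (cubeGraph c).Connected := h.mono <| cubeGraph_mono fun j hj => by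
      by_cases hji : j = i
      · subst hji; simp [closeEdge] at hj
      · simpa [closeEdge, hji] using hj
    simp [connInd, h, h']
  · simpa [connInd, h] using connInd_nonneg c

lemma not_mem_farEdges_self (i : Fin 12) : i ∉ farEdges i := fun h => h.1 rfl

/-! ### Models on the 3-cube, thinning and duality. -/

/-- A positive functional on the configurations of the cube (integration against a finite measure)
for which an edge is independent of the edges sharing no vertex with it. -/
structure IsCubeModel (E : ((Fin 12 → Bool) → ℝ) →ₗ[ℝ] ℝ) : Prop where
  nonneg : ∀ f, 0 ≤ f → 0 ≤ E f
  pos : 0 < E 1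
  indep : ∀ i f, DependsOn f (farEdges i) → E (edgeInd i * f) * E 1 = E (edgeInd i) * E f

lemma IsCubeModel.mono {E : ((Fin 12 → Bool) → ℝ) →ₗ[ℝ] ℝ} (hE : IsCubeModel E)
    {f g : (Fin 12 → Bool) → ℝ} (h : f ≤ g) : E f ≤ E g := by
  have := hE.nonneg (g - f) (sub_nonneg.2 h)
  rw [map_sub] at this
  linarith

/-- Independently close the `i`-th edge with probability `1 - r`. -/
noncomputable def thinEdge (E : ((Fin 12 → Bool) → ℝ) →ₗ[ℝ] ℝ) (i : Fin 12) (r : ℝ) :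
    ((Fin 12 → Bool) → ℝ) →ₗ[ℝ] ℝ :=
  r • E + (1 - r) • E ∘ₗ LinearMap.funLeft ℝ ℝ (closeEdge i)

lemma thinEdge_apply (E : ((Fin 12 → Bool) → ℝ) →ₗ[ℝ] ℝ) (i : Fin 12) (r : ℝ)
    (f : (Fin 12 → Bool) → ℝ) :
    thinEdge E i r f = r * E f + (1 - r) * E (f ∘ closeEdge i) := rfl

lemma edgeInd_comp_closeEdge_self (i : Fin 12) : edgeInd i ∘ closeEdge i = 0 := by
  funext c; simp [edgeInd, closeEdge]

lemma edgeInd_comp_closeEdge {i j : Fin 12} (h : j ≠ i) :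
    edgeInd j ∘ closeEdge i = edgeInd j := by
  funext c; simp [edgeInd, closeEdge, h]

lemma thinEdge_one (E : ((Fin 12 → Bool) → ℝ) →ₗ[ℝ] ℝ) (i : Fin 12) (r : ℝ) :
    thinEdge E i r 1 = E 1 := by
  rw [thinEdge_apply]
  have : (1 : (Fin 12 → Bool) → ℝ) ∘ closeEdge i = 1 := rfl
  rw [this]; ring

lemma DependsOn.comp_closeEdge {f : (Fin 12 → Bool) → ℝ} {s : Set (Fin 12)} (hf : DependsOn f s)
    (i : Fin 12) : DependsOn (f ∘ closeEdge i) s := by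
  intro c c' h
  refine hf fun j hj => ?_
  by_cases hji : j = i
  · subst hji; simp [closeEdge]
  · simpa [closeEdge, hji] using h j hj

lemma DependsOn.comp_closeEdge_eq {f : (Fin 12 → Bool) → ℝ} {s : Set (Fin 12)}
    (hf : DependsOn f s) {i : Fin 12} (hi : i ∉ s) : f ∘ closeEdge i = f := by
  funext c
  refine hf fun j hj => ?_
  have : j ≠ i := fun h => hi (h ▸ hj)
  simp [closeEdge, this]

/-- For `j ≠ i`, thinning leaves `E 1` and `E (edgeInd j)` unchanged, so the identity for `j` is a
linear combination of those for `f` and `f ∘ closeEdge i`, which depends on the same edges. For `j =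
i`, `f` does not see the thinned edge and both sides scale by `r`. -/
lemma IsCubeModel.thin {E : ((Fin 12 → Bool) → ℝ) →ₗ[ℝ] ℝ} (hE : IsCubeModel E) (i : Fin 12)
    {r : ℝ} (h0 : 0 ≤ r) (h1 : r ≤ 1) : IsCubeModel (thinEdge E i r) where
  nonneg f hf := by
    rw [thinEdge_apply]
    have h2 := hE.nonneg f hf
    have h3 := hE.nonneg (f ∘ closeEdge i) fun c => hf (closeEdge i c)
    have : 0 ≤ 1 - r := by linarith
    positivity
  pos := by rw [thinEdge_one]; exact hE.pos
  indep j f hf := by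
    have hmul : (edgeInd j * f) ∘ closeEdge i = (edgeInd j ∘ closeEdge i) * (f ∘ closeEdge i) := rfl
    rw [thinEdge_one, thinEdge_apply, thinEdge_apply, thinEdge_apply, hmul]
    have key := hE.indep j f hf
    by_cases hji : j = i
    · subst hji
      rw [edgeInd_comp_closeEdge_self, hf.comp_closeEdge_eq (not_mem_farEdges_self _), zero_mul,
        map_zero]
      linear_combination r * key
    · have key' := hE.indep j _ (hf.comp_closeEdge i)
      rw [edgeInd_comp_closeEdge hji]
      linear_combination r * key + (1 - r) * key'

/-- A dual certificate bounds the connection probability in every model on the cube in which every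
edge is open with probability at least `p`. -/
theorem IsCubeModel.mul_le_connInd {p α : ℝ} (hp0 : 0 < p) {g : Fin 12 → (Fin 12 → Bool) → ℝ}
    (hg : ∀ i, DependsOn (g i) (farEdges i))
    (cert : ∀ c, ∑ i, g i c * (edgeInd i c - p) + α ≤ connInd c)
    {E : ((Fin 12 → Bool) → ℝ) →ₗ[ℝ] ℝ} (hE : IsCubeModel E)
    (hp : ∀ i, p * E 1 ≤ E (edgeInd i)) : α * E 1 ≤ E connInd := by
  -- The multipliers may be negative, so edge probabilities must be reduced to exactly `p`. Here `s`
  -- holds the edges whose probability may still exceed `p`.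
  suffices H : ∀ (s : Finset (Fin 12)) (E : ((Fin 12 → Bool) → ℝ) →ₗ[ℝ] ℝ), IsCubeModel E →
      (∀ i, p * E 1 ≤ E (edgeInd i)) → (∀ i ∉ s, p * E 1 = E (edgeInd i)) →
      α * E 1 ≤ E connInd from
    H Finset.univ E hE hp fun i hi => absurd (Finset.mem_univ i) hi
  intro s
  induction s using Finset.induction_on with
  | empty =>
    intro E hE _ hp
    have h1 := hE.mono (f := ∑ i, g i * (edgeInd i - p • 1) + α • 1) (g := connInd) fun c => by
      simpa [Finset.sum_apply] using cert c
    rw [map_add, map_sum, map_smul, smul_eq_mul] at h1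
    have h2 : ∀ i, E (g i * (edgeInd i - p • 1)) = 0 := fun i => by
      have h3 : g i * (edgeInd i - p • 1) = edgeInd i * g i - p • g i := by
        funext c; simp; ring
      have h4 := hE.indep i (g i) (hg i)
      rw [h3, map_sub, map_smul, smul_eq_mul]
      rw [← hp i (by simp)] at h4
      have h5 := hE.pos.ne'
      apply mul_right_cancel₀ h5
      linear_combination h4
    simpa [h2] using h1
  | insert i s _ ih =>
    intro E hE hle hp
    have hpos : 0 < E (edgeInd i) := lt_of_lt_of_le (mul_pos hp0 hE.pos) (hle i)
    -- The retention probability that brings edge `i` down to exactly `p`.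
    set r := p * E 1 / E (edgeInd i) with hr
    have hr0 : 0 ≤ r := div_nonneg (mul_pos hp0 hE.pos).le hpos.le
    have hr1 : r ≤ 1 := (div_le_one hpos).2 (hle i)
    have hri : r * E (edgeInd i) = p * E 1 := div_mul_cancel₀ _ hpos.ne'
    have hi : thinEdge E i r (edgeInd i) = p * E 1 := by
      rw [thinEdge_apply, edgeInd_comp_closeEdge_self, map_zero, hri]; ring
    have hj : ∀ j, j ≠ i → thinEdge E i r (edgeInd j) = E (edgeInd j) := fun j hj => by
      rw [thinEdge_apply, edgeInd_comp_closeEdge hj]; ring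
    have key := ih (thinEdge E i r) (hE.thin i hr0 hr1)
      (fun j => by
        rw [thinEdge_one]
        by_cases hji : j = i
        · subst hji; exact hi.ge
        · rw [hj j hji]; exact hle j)
      (fun j hjs => by
        rw [thinEdge_one]
        by_cases hji : j = i
        · subst hji; exact hi.symm
        · rw [hj j hji]; exact hp j (by simp [hji, hjs]))
    rw [thinEdge_one, thinEdge_apply] at key
    have hmono : E (connInd ∘ closeEdge i) ≤ E connInd :=
      hE.mono fun c => connInd_closeEdge_le i c
    nlinarith [mul_le_mul_of_nonneg_left hmono (sub_nonneg.2 hr1)]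

/-! ### Encoding of the dual certificates: by symmetry one table of 128 multipliers, indexed by the
states of seven edges, serves all twelve edges. -/

/-- The edges of the cube sharing no vertex with the `i`-th edge, listed compatibly with a symmetry
of the cube taking the `i`-th edge to the first. -/
def farEdgeList : Fin 12 → List (Fin 12) :=
  ![[1, 2, 3, 5, 7, 10, 11], [0, 3, 2, 5, 7, 8, 9], [3, 0, 1, 4, 6, 10, 11],
    [2, 1, 0, 4, 6, 8, 9], [5, 6, 7, 9, 11, 2, 3], [4, 7, 6, 9, 11, 0, 1],
    [7, 4, 5, 8, 10, 2, 3], [6, 5, 4, 8, 10, 0, 1], [9, 10, 11, 1, 3, 6, 7],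
    [8, 11, 10, 1, 3, 4, 5], [11, 8, 9, 0, 2, 6, 7], [10, 9, 8, 0, 2, 4, 5]]

/-- `farEdgeList` as a table of natural numbers, for fast evaluation. -/
def farEdgeTable : List (ℕ × List ℕ) :=
  [(0, [1, 2, 3, 5, 7, 10, 11]), (1, [0, 3, 2, 5, 7, 8, 9]), (2, [3, 0, 1, 4, 6, 10, 11]),
    (3, [2, 1, 0, 4, 6, 8, 9]), (4, [5, 6, 7, 9, 11, 2, 3]), (5, [4, 7, 6, 9, 11, 0, 1]),
    (6, [7, 4, 5, 8, 10, 2, 3]), (7, [6, 5, 4, 8, 10, 0, 1]), (8, [9, 10, 11, 1, 3, 6, 7]),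
    (9, [8, 11, 10, 1, 3, 4, 5]), (10, [11, 8, 9, 0, 2, 6, 7]), (11, [10, 9, 8, 0, 2, 4, 5])]

/-- The edges of the cube, each with the bit mask of its two vertices. -/
def edgeMaskTable : List (ℕ × ℕ) :=
  [(0, 3), (1, 12), (2, 48), (3, 192), (4, 5), (5, 80), (6, 10), (7, 160), (8, 17), (9, 34),
    (10, 68), (11, 136)]

/-- The `j`-th binary digit of `n`. -/
def bit (n j : ℕ) : Bool := Nat.beq (Nat.land 1 (Nat.shiftRight n j)) 1

/-- The configuration with binary number `n`. -/
def bitConfig (n : ℕ) (i : Fin 12) : Bool := bit n i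

/-- The states of the listed edges in the configuration with number `n`, as a binary number. -/
def farKey (n : ℕ) (l : List ℕ) : ℕ :=
  l.foldr (fun j k => Nat.add (Nat.mul 2 k) (bif bit n j then 1 else 0)) 0

/-- The `k`-th digit of `T` in base `2 ^ w`. -/
def digit (w T k : ℕ) : ℕ := Nat.mod (Nat.shiftRight T (Nat.mul w k)) (Nat.pow 2 w)

/-- The total of the dual certificate with multipliers `digit w T k - K` at `p = P / 10000`, scaled
by `10000` and with `P * 2 ^ w + (10000 - P) * K` added to each term. -/
def certSum (w T K P n : ℕ) : ℕ :=
  farEdgeTable.foldr (fun e s => Nat.add s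
    (bif bit n e.1 then Nat.add (Nat.mul (10000 - P) (digit w T (farKey n e.2))) (P * 2 ^ w)
      else Nat.sub (P * 2 ^ w + 10000 * K) (Nat.mul P (digit w T (farKey n e.2))))) 0

/-- Enlarge a set of vertices of the cube (a bit mask) along an edge if it is open. -/
def reachStep (n m : ℕ) (e : ℕ × ℕ) : ℕ :=
  bif bit n e.1 then (bif Nat.beq (Nat.land m e.2) 0 then m else Nat.lor m e.2) else m

/-- The vertices of the cube reached from `0` by sweeping `k` times over the edges. -/
def reachMask (n : ℕ) : ℕ → ℕ
  | 0 => 1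
  | k + 1 => edgeMaskTable.foldl (reachStep n) (reachMask n k)

/-- Whether the dual certificate is valid at the configuration with number `n`. -/
def certValid (w T K P D A n : ℕ) : Bool :=
  let l := Nat.add (certSum w T K P n) A
  let r := 12 * (P * 2 ^ w + (10000 - P) * K)
  Nat.ble l r || (Nat.ble l (Nat.add r (D * 10000)) && Nat.beq (reachMask n 5) 255)

/-- Whether the dual certificate is valid at every configuration. -/
def certValidAll (w T K P D A : ℕ) : Bool :=
  (List.range 64).all fun a => (List.range 64).all fun b => certValid w T K P D A (64 * a + b)

/-- The multipliers of the dual certificate at `p = 0.5847`. -/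
def certTable₁ : ℕ := 0x7458619ca8672a4c3f8b52a44e79139f0d4070cc98ae749abf0d40aec64319275ef1f17270cc98ae749abf0d40aec64319275ef1f172a50a5e75fb850a57b8a8b358299aa481cae370cc926af62b9f0d40aec65d7bc0c649f17284e4c76ff1dbfef766a84f0000000000947d4bac8c118304630d40a46dc4464111912cca9c680a14caa3aa90edbc5f9a65a40cdd877670cc926af62b9f0d40aec65d7bc0c649f1724bac8c118304630d40a46dc4464111912cca84e4c76ff1dbfef766a84f0000000000947d9c680a14caa3aa90edbc5f9a65a40cdd8776a50a6e14279d7e57b8a8b36a92060a65cae39c682a8ea2853290edbc5f903376996987769c682a8ea2853290edbc5f903376996987768b4a9e55579556c4dfc35020edc83b71b737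

/-- The multipliers of the dual certificate at `p = 0.5868`. -/
def certTable₂ : ℕ := 0x95159ab35d2b1975eebfd0908fc57afd0e081ee5ecf8908fc57afd0e081ee5ecf8d3f3afafdf8d7ef7b6948e908bd5f8fd0e092f43dcf8ab84f09e797d6c000001726007b8f77d0d1c2d85b307c926876e68bf090e54c3f0908bd5f8fd0e092f43dcf86007b8f77d0d1c2d85b307ab84f09e797d6c00000172c926876e68bf090e54c3f0d3fd7e75df8d7fb49ef48ec93b70d0e8bf08a621cbf0c93b70d0e8bf08a621cbf0b2935e6bf2ffa14de9bc80

/-- The multipliers are `(digit - 100000) / 100000`, and `46280000 / (100000 * 10000) = 0.04628`. -/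
lemma certValidAll₁ : certValidAll 18 certTable₁ 100000 5847 100000 46280000 = true := by
  decide +kernel

/-- Here the constant is `475000 / (1000 * 10000) = 0.0475`. -/
lemma certValidAll₂ : certValidAll 11 certTable₂ 1000 5868 1000 475000 = true := by
  decide +kernel

/-! ### Soundness of the certificate check. -/

lemma bit_eq_testBit (n j : ℕ) : bit n j = n.testBit j := by
  have h : Nat.land 1 (Nat.shiftRight n j) = (n >>> j) % 2 := by
    change 1 &&& (n >>> j) = _
    rw [Nat.land_comm, Nat.and_one_is_mod]
  rw [bit, h, Nat.testBit_eq_decide_div_mod_eq, Nat.shiftRight_eq_div_pow, Bool.eq_iff_iff]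
  simp

lemma exists_bitConfig (c : Fin 12 → Bool) :
    ∃ a < 64, ∃ b < 64, bitConfig (64 * a + b) = c := by
  have hlt := Nat.ofBits_lt_two_pow c
  refine ⟨Nat.ofBits c / 64, by omega, Nat.ofBits c % 64, by omega, ?_⟩
  funext i
  rw [Nat.div_add_mod, bitConfig, bit_eq_testBit]
  simp [Nat.testBit_ofBits_lt]

lemma farEdgeTable_eq :
    farEdgeTable = (List.finRange 12).map fun i : Fin 12 => (i.val, (farEdgeList i).map Fin.val) := by
  decide

lemma edgeMaskTable_eq : edgeMaskTable = (List.finRange 12).map fun i : Fin 12 =>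
    (i.val, 2 ^ ((cubeEdge i).1 : ℕ) ||| 2 ^ ((cubeEdge i).2 : ℕ)) := by
  decide

/-- The states of the edges sharing no vertex with the `i`-th edge, as a binary number. -/
def farCode (i : Fin 12) (c : Fin 12 → Bool) : ℕ :=
  (farEdgeList i).foldr (fun j k => 2 * k + (bif c j then 1 else 0)) 0

lemma farKey_eq_farCode (n : ℕ) (i : Fin 12) :
    farKey n ((farEdgeList i).map Fin.val) = farCode i (bitConfig n) := by
  simp only [farKey, farCode, List.foldr_map, bitConfig]
  rfl

lemma farEdgeList_subset (i j : Fin 12) (hj : j ∈ farEdgeList i) : j ∈ farEdges i := by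
  have : ∀ i, ∀ j ∈ farEdgeList i, (cubeEdge i).1 ≠ (cubeEdge j).1 ∧
      (cubeEdge i).1 ≠ (cubeEdge j).2 ∧
      (cubeEdge i).2 ≠ (cubeEdge j).1 ∧ (cubeEdge i).2 ≠ (cubeEdge j).2 := by decide
  exact this i j hj

lemma dependsOn_farCode (i : Fin 12) : DependsOn (farCode i) (farEdges i) := by
  intro c c' h
  have : ∀ l : List (Fin 12), (∀ j ∈ l, j ∈ farEdges i) →
      l.foldr (fun j k => 2 * k + (bif c j then 1 else 0)) 0 =
        l.foldr (fun j k => 2 * k + (bif c' j then 1 else 0)) 0 := by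
    intro l
    induction l with
    | nil => simp
    | cons j l ih =>
      intro hl
      simp only [List.foldr_cons]
      rw [ih fun k hk => hl k (List.mem_cons_of_mem _ hk), h j (hl j List.mem_cons_self)]
  exact this _ (farEdgeList_subset i)

lemma certSum_eq (w T K P n : ℕ) : certSum w T K P n = ∑ i : Fin 12,
    (bif bitConfig n i then (10000 - P) * digit w T (farCode i (bitConfig n)) + P * 2 ^ w
      else (P * 2 ^ w + 10000 * K) - P * digit w T (farCode i (bitConfig n))) := by
  have : ∀ (f : Fin 12 → ℕ) (l : List (Fin 12)),
      l.foldr (fun i s => Nat.add s (f i)) 0 = (l.map f).sum := by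
    intro f l
    induction l with
    | nil => rfl
    | cons i l ih => rw [List.foldr_cons, ih, List.map_cons, List.sum_cons]; exact add_comm _ _
  rw [certSum, farEdgeTable_eq, List.foldr_map, this, Fin.sum_univ_def]
  simp only [farKey_eq_farCode]
  rfl

lemma digit_lt (w T k : ℕ) : digit w T k < 2 ^ w := Nat.mod_lt _ (Nat.two_pow_pos w)

/-- A set of vertices reachable from `0` that meets an open edge may absorb both ends of it. Whether
finitely many sweeps find every reachable vertex is irrelevant: the check only needs a full mask to
imply connectedness. -/
lemma reachMask_sound (n k : ℕ) (v : Fin 8) (hv : (reachMask n k).testBit v) :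
    (cubeGraph (bitConfig n)).Reachable 0 v := by
  set c := bitConfig n with hc
  have adj : ∀ i, c i = true → (cubeGraph c).Adj (cubeEdge i).1 (cubeEdge i).2 := fun i hi => by
    have hne : ∀ i, (cubeEdge i).1 ≠ (cubeEdge i).2 := by decide
    rw [cubeGraph, SimpleGraph.fromRel_adj]
    exact ⟨hne i, Or.inl ⟨i, hi, rfl⟩⟩
  have main : ∀ (l : List (Fin 12)) (m : ℕ),
      (∀ v : Fin 8, m.testBit v → (cubeGraph c).Reachable 0 v) → ∀ v : Fin 8,
      ((l.map fun i : Fin 12 => (i.val, 2 ^ ((cubeEdge i).1 : ℕ) ||| 2 ^ ((cubeEdge i).2 : ℕ))).foldl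
        (reachStep n) m).testBit v → (cubeGraph c).Reachable 0 v := by
    intro l
    induction l with
    | nil => exact fun m hm => hm
    | cons i l ih =>
      intro m hm
      refine ih _ fun v hv => ?_
      simp only [reachStep] at hv
      cases hi : bit n i with
      | false => rw [hi] at hv; exact hm v hv
      | true =>
        rw [hi, cond_true] at hv
        cases hb : Nat.beq (Nat.land m (2 ^ ((cubeEdge i).1 : ℕ) ||| 2 ^ ((cubeEdge i).2 : ℕ))) 0 with
        | true => rw [hb] at hv; exact hm v hv
        | false =>
          rw [hb, cond_false] at hv
          have hne : m &&& (2 ^ ((cubeEdge i).1 : ℕ) ||| 2 ^ ((cubeEdge i).2 : ℕ)) ≠ 0 :=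
            Nat.ne_of_beq_eq_false hb
          obtain ⟨j, hj⟩ := Nat.exists_testBit_of_ne_zero hne
          simp only [Nat.testBit_and, Nat.testBit_or, Nat.testBit_two_pow, Bool.and_eq_true,
            Bool.or_eq_true, decide_eq_true_eq] at hj
          have h1 : (cubeGraph c).Reachable 0 (cubeEdge i).1 ∧
              (cubeGraph c).Reachable 0 (cubeEdge i).2 := by
            rcases hj with ⟨hm', rfl | rfl⟩
            · exact ⟨hm _ hm', (hm _ hm').trans (adj i hi).reachable⟩
            · exact ⟨(hm _ hm').trans (adj i hi).reachable.symm, hm _ hm'⟩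
          change (m ||| (2 ^ ((cubeEdge i).1 : ℕ) ||| 2 ^ ((cubeEdge i).2 : ℕ))).testBit v = true
            at hv
          simp only [Nat.testBit_or, Bool.or_eq_true, Nat.testBit_two_pow, decide_eq_true_eq] at hv
          rcases hv with h | h | h
          · exact hm v h
          · rw [← Fin.ext h]; exact h1.1
          · rw [← Fin.ext h]; exact h1.2
  induction k generalizing v with
  | zero =>
    have : ∀ v : Fin 8, (1 : ℕ).testBit v → v = 0 := by decide
    rw [this v hv]
  | succ k ih =>
    rw [reachMask, edgeMaskTable_eq] at hv
    exact main _ _ ih v hv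

lemma connected_of_reachMask {n k : ℕ} (h : reachMask n k = 255) :
    (cubeGraph (bitConfig n)).Connected := by
  have h0 : ∀ v, (cubeGraph (bitConfig n)).Reachable 0 v := fun v =>
    reachMask_sound n k v <| by rw [h]; revert v; decide
  exact ⟨fun u v => (h0 u).symm.trans (h0 v)⟩

/-- A numerically verified dual certificate bounds the connection probability in every model on the
cube. -/
theorem IsCubeModel.mul_le_connInd_of_certValidAll {w T K P D A : ℕ} (hP : 0 < P) (hP' : P ≤ 10000)
    (hD : 0 < D) (h : certValidAll w T K P D A = true)
    {E : ((Fin 12 → Bool) → ℝ) →ₗ[ℝ] ℝ} (hE : IsCubeModel E)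
    (hp : ∀ i, (P / 10000 : ℝ) * E 1 ≤ E (edgeInd i)) :
    (A / (D * 10000) : ℝ) * E 1 ≤ E connInd := by
  refine hE.mul_le_connInd (p := P / 10000) (by positivity)
    (g := fun i c => ((digit w T (farCode i c) : ℝ) - K) / D) ?_ ?_ hp
  · intro i c c' hc
    simp only [dependsOn_farCode i hc]
  · intro c
    have hD' : (0 : ℝ) < D := by exact_mod_cast hD
    obtain ⟨a, ha, b, hb, rfl⟩ := exists_bitConfig c
    have hv := List.all_eq_true.1 (List.all_eq_true.1 h a (List.mem_range.2 ha)) b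
      (List.mem_range.2 hb)
    set n := 64 * a + b
    have hsum : ∑ i, ((digit w T (farCode i (bitConfig n)) : ℝ) - K) / D *
        (edgeInd i (bitConfig n) - P / 10000) + A / (D * 10000) =
        ((certSum w T K P n + A : ℕ) - (12 * (P * 2 ^ w + (10000 - P) * K) : ℕ) : ℝ) /
          (D * 10000) := by
      have h12 : ((12 * (P * 2 ^ w + (10000 - P) * K) : ℕ) : ℝ) =
          ∑ _i : Fin 12, ((P : ℝ) * 2 ^ w + (10000 - P) * K) := by
        simp [Nat.cast_sub hP']
        ring
      rw [h12, certSum_eq]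
      push_cast
      rw [add_sub_right_comm, ← Finset.sum_sub_distrib, add_div, Finset.sum_div]
      congr 1
      refine Finset.sum_congr rfl fun i _ => ?_
      -- Digits lie below `2 ^ w`, so the shift makes the truncated subtraction in `certSum` exact.
      have hle : P * digit w T (farCode i (bitConfig n)) ≤ P * 2 ^ w + 10000 * K :=
        (Nat.mul_le_mul_left P (digit_lt _ _ _).le).trans (Nat.le_add_right _ _)
      cases hci : bitConfig n i
      · simp [edgeInd, hci, Nat.cast_sub hle]
        field_simp
        ring
      · simp [edgeInd, hci, Nat.cast_sub hP']
        field_simp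
        ring
    rw [hsum]
    simp only [certValid, Bool.or_eq_true, Bool.and_eq_true] at hv
    rcases hv with hv | ⟨hv, hr⟩
    · refine le_trans ?_ (connInd_nonneg _)
      have := Nat.le_of_ble_eq_true hv
      refine div_nonpos_of_nonpos_of_nonneg (sub_nonpos.2 ?_) (by positivity)
      exact_mod_cast this
    · rw [connInd, if_pos (connected_of_reachMask (Nat.eq_of_beq_eq_true hr)),
        div_le_one (by positivity), sub_le_iff_le_add']
      have := Nat.le_of_ble_eq_true hv
      exact_mod_cast this

/-! ### Factorisation of expectations over disjoint vertex sets. -/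

section OneIndependent

variable {V : Type*} {G : SimpleGraph V}

/-- The edges of `G` with both ends in `A`. -/
def edgesIn (G : SimpleGraph V) (A : Set V) : Set G.edgeSet := {e | ∀ v ∈ (e : Sym2 V), v ∈ A}

lemma edgesIn_mono {A B : Set V} (h : A ⊆ B) : edgesIn G A ⊆ edgesIn G B :=
  fun _ he v hv => h (he v hv)

lemma vertexDisjoint_edgesIn {A B : Set V} (h : Disjoint A B) :
    VertexDisjoint (edgesIn G A) (edgesIn G B) :=
  fun _ he _ hf v hv hv' => Set.disjoint_left.1 h (he v hv) (hf v hv')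

lemma DependsOn.mul_real {F H : BondConfig G → ℝ} {S : Set G.edgeSet} (hF : DependsOn F S)
    (hH : DependsOn H S) : DependsOn (F * H) S :=
  fun ω ω' h => by simp only [Pi.mul_apply, hF h, hH h]

lemma DependsOn.prod_real {ι : Type*} {s : Finset ι} {F : ι → BondConfig G → ℝ}
    {S : Set G.edgeSet} (hF : ∀ i ∈ s, DependsOn (F i) S) : DependsOn (∏ i ∈ s, F i) S :=
  fun ω ω' h => by
    simp only [Finset.prod_apply]
    exact Finset.prod_congr rfl fun i hi => hF i hi h

variable [Finite V] {μ : Measure (BondConfig G)}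

lemma OneIndependent.integral_mul (h : OneIndependent μ) {A B : Set V} (hAB : Disjoint A B)
    {F H : BondConfig G → ℝ} (hF : DependsOn F (edgesIn G A)) (hH : DependsOn H (edgesIn G B)) :
    ∫ ω, (F * H) ω ∂μ = (∫ ω, F ω ∂μ) * ∫ ω, H ω ∂μ := by
  obtain ⟨F', rfl⟩ := dependsOn_iff_exists_comp.1 hF
  obtain ⟨H', rfl⟩ := dependsOn_iff_exists_comp.1 hH
  have hind := (h _ _ (vertexDisjoint_edgesIn hAB)).comp (φ := F') (ψ := H')
    Measurable.of_discrete Measurable.of_discrete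
  exact hind.integral_mul_eq_mul_integral
    Measurable.of_discrete.aestronglyMeasurable Measurable.of_discrete.aestronglyMeasurable

lemma OneIndependent.integral_prod [IsProbabilityMeasure μ] (h : OneIndependent μ) {ι : Type*}
    {A : ι → Set V} (hA : Pairwise (Function.onFun Disjoint A)) {F : ι → BondConfig G → ℝ}
    (hF : ∀ i, DependsOn (F i) (edgesIn G (A i))) (s : Finset ι) :
    ∫ ω, (∏ i ∈ s, F i) ω ∂μ = ∏ i ∈ s, ∫ ω, F i ω ∂μ := by
  classical
  induction s using Finset.induction_on with
  | empty => simp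
  | insert i s hi ih =>
    rw [Finset.prod_insert hi, Finset.prod_insert hi, ← ih]
    refine h.integral_mul (B := ⋃ j ∈ s, A j) ?_ (hF i) (DependsOn.prod_real fun j hj =>
      (hF j).mono (edgesIn_mono (Set.subset_biUnion_of_mem (u := A) hj)))
    simp only [Set.disjoint_iUnion_right]
    exact fun j hj => hA fun hij => hi (hij ▸ hj)

end OneIndependent

/-! ### The fibration of `Q_6` over the 3-cube. -/

/-- The vertex of `Q_6 = Q_3 × Q_3` in the fibre over `a` at position `b`. -/
def cubePoint (a b : Fin 8) (k : Fin 6) : Bool := (8 * a.val + b.val).testBit k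

lemma cubePoint_injective {a b a' b' : Fin 8} (h : cubePoint a b = cubePoint a' b') :
    a = a' ∧ b = b' := by
  have : 8 * a.val + b.val = 8 * a'.val + b'.val := by
    refine Nat.eq_of_testBit_eq fun k => ?_
    by_cases hk : k < 6
    · exact congrFun h ⟨k, hk⟩
    · have h2 : 2 ^ 6 ≤ 2 ^ k := Nat.pow_le_pow_right (by norm_num) (by omega)
      rw [Nat.testBit_lt_two_pow (by omega), Nat.testBit_lt_two_pow (by omega)]
  constructor <;> ext <;> omega

lemma cubePoint_surjective (x : Fin 6 → Bool) : ∃ a b, cubePoint a b = x := by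
  have hlt := Nat.ofBits_lt_two_pow x
  refine ⟨⟨Nat.ofBits x / 8, by omega⟩, ⟨Nat.ofBits x % 8, by omega⟩, ?_⟩
  funext k
  simp only [cubePoint, Nat.div_add_mod]
  simp [Nat.testBit_ofBits_lt]

lemma hypercube_adj_inner (a : Fin 8) (i : Fin 12) :
    (hypercube 6).Adj (cubePoint a (cubeEdge i).1) (cubePoint a (cubeEdge i).2) := by
  have : ∀ (a : Fin 8) (i : Fin 12), hammingDist (cubePoint a (cubeEdge i).1)
      (cubePoint a (cubeEdge i).2) = 1 := by decide +kernel
  exact this a i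

lemma hypercube_adj_cross (i : Fin 12) (b : Fin 8) :
    (hypercube 6).Adj (cubePoint (cubeEdge i).1 b) (cubePoint (cubeEdge i).2 b) := by
  have : ∀ (i : Fin 12) (b : Fin 8), hammingDist (cubePoint (cubeEdge i).1 b)
      (cubePoint (cubeEdge i).2 b) = 1 := by decide +kernel
  exact this i b

/-- The edge `i` of the fibre over `a`. -/
def innerEdge (a : Fin 8) (i : Fin 12) : (hypercube 6).edgeSet :=
  ⟨s(cubePoint a (cubeEdge i).1, cubePoint a (cubeEdge i).2), hypercube_adj_inner a i⟩

/-- The edge at position `b` between the fibres over the ends of `i`. -/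
def crossEdge (i : Fin 12) (b : Fin 8) : (hypercube 6).edgeSet :=
  ⟨s(cubePoint (cubeEdge i).1 b, cubePoint (cubeEdge i).2 b), hypercube_adj_cross i b⟩

/-- The configuration in the fibre over `a`. -/
def innerConfig (a : Fin 8) (ω : BondConfig (hypercube 6)) (i : Fin 12) : Bool := ω (innerEdge a i)

/-- The configuration on the cube in which an edge is open if the fibres over its ends are joined by
an open edge. -/
def crossConfig (ω : BondConfig (hypercube 6)) (i : Fin 12) : Bool :=
  decide (∃ b, ω (crossEdge i b) = true)

/-- Indicator that the fibre over `a` is internally connected. -/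
noncomputable def fibreInd (a : Fin 8) (ω : BondConfig (hypercube 6)) : ℝ :=
  connInd (innerConfig a ω)

/-- The union of the fibres over `S`. -/
def fibres (S : Set (Fin 8)) : Set (Fin 6 → Bool) := {x | ∃ a ∈ S, ∃ b, cubePoint a b = x}

lemma disjoint_fibres {S T : Set (Fin 8)} (h : Disjoint S T) : Disjoint (fibres S) (fibres T) := by
  rw [Set.disjoint_left]
  rintro x ⟨a, ha, b, rfl⟩ ⟨a', ha', b', h'⟩
  exact Set.disjoint_left.1 h ha ((cubePoint_injective h').1 ▸ ha')

lemma innerEdge_mem_fibres {a : Fin 8} {S : Set (Fin 8)} (ha : a ∈ S) (i : Fin 12) :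
    innerEdge a i ∈ edgesIn (hypercube 6) (fibres S) := by
  intro v hv
  simp only [innerEdge, Sym2.mem_iff] at hv
  rcases hv with rfl | rfl <;> exact ⟨a, ha, _, rfl⟩

lemma crossEdge_mem_fibres {i : Fin 12} {S : Set (Fin 8)} (h1 : (cubeEdge i).1 ∈ S)
    (h2 : (cubeEdge i).2 ∈ S) (b : Fin 8) :
    crossEdge i b ∈ edgesIn (hypercube 6) (fibres S) := by
  intro v hv
  simp only [crossEdge, Sym2.mem_iff] at hv
  rcases hv with rfl | rfl
  exacts [⟨_, h1, _, rfl⟩, ⟨_, h2, _, rfl⟩]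

lemma dependsOn_fibreInd {a : Fin 8} {S : Set (Fin 8)} (ha : a ∈ S) :
    DependsOn (fibreInd a) (edgesIn (hypercube 6) (fibres S)) := fun ω ω' h => by
  have : innerConfig a ω = innerConfig a ω' := funext fun i => h _ (innerEdge_mem_fibres ha i)
  simp only [fibreInd, this]

lemma crossConfig_congr {S : Set (Fin 8)} {ω ω' : BondConfig (hypercube 6)}
    (h : ∀ e ∈ edgesIn (hypercube 6) (fibres S), ω e = ω' e) {i : Fin 12}
    (h1 : (cubeEdge i).1 ∈ S) (h2 : (cubeEdge i).2 ∈ S) : crossConfig ω i = crossConfig ω' i := by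
  simp only [crossConfig, h _ (crossEdge_mem_fibres h1 h2 _)]

/-- The ends of the `i`-th edge of the cube. -/
def edgeEnds (i : Fin 12) : Finset (Fin 8) := {(cubeEdge i).1, (cubeEdge i).2}

lemma notMem_edgeEnds_of_mem_farEdges {i j : Fin 12} (h : j ∈ farEdges i) :
    (cubeEdge j).1 ∉ edgeEnds i ∧ (cubeEdge j).2 ∉ edgeEnds i := by
  obtain ⟨h1, h2, h3, h4⟩ := h
  simp [edgeEnds, h1.symm, h2.symm, h3.symm, h4.symm]

/-! ### The inner and outer cube models. -/

section Model

variable (μ : Measure (BondConfig (hypercube 6)))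

/-- Integration against the law of the cube configuration `X` weighted by `W`. -/
noncomputable def lawFunctional [IsFiniteMeasure μ] (W : BondConfig (hypercube 6) → ℝ)
    (X : BondConfig (hypercube 6) → Fin 12 → Bool) : ((Fin 12 → Bool) → ℝ) →ₗ[ℝ] ℝ where
  toFun f := ∫ ω, W ω * f (X ω) ∂μ
  map_add' f g := by
    simp only [Pi.add_apply, mul_add]
    exact integral_add .of_finite .of_finite
  map_smul' r f := by
    simp only [Pi.smul_apply, smul_eq_mul, RingHom.id_apply, mul_left_comm _ r]
    exact integral_const_mul _ _

variable {μ}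

lemma integral_edge_eq (e : (hypercube 6).edgeSet) :
    ∫ ω, (if ω e = true then (1 : ℝ) else 0) ∂μ = μ.real {ω | ω e = true} := by
  rw [← integral_indicator_one (MeasurableSet.of_discrete)]
  simp [Set.indicator_apply]

variable [IsProbabilityMeasure μ]

lemma isCubeModel_inner (h : OneIndependent μ) (a : Fin 8) :
    IsCubeModel (lawFunctional μ 1 (innerConfig a)) where
  nonneg f hf := integral_nonneg fun ω => by simpa using hf (innerConfig a ω)
  pos := by simp [lawFunctional]
  indep i f hf := by
    have h1 : lawFunctional μ 1 (innerConfig a) 1 = 1 := by simp [lawFunctional]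
    rw [h1, mul_one]
    have key := h.integral_mul (A := {x | ∃ b ∈ edgeEnds i, cubePoint a b = x})
      (B := {x | ∃ b ∉ edgeEnds i, cubePoint a b = x}) (F := fun ω => edgeInd i (innerConfig a ω))
      (H := fun ω => f (innerConfig a ω)) ?_ ?_ ?_
    · simpa [lawFunctional] using key
    · rw [Set.disjoint_left]
      rintro x ⟨b, hb, rfl⟩ ⟨b', hb', h'⟩
      exact hb' ((cubePoint_injective h').2 ▸ hb)
    · intro ω ω' hω
      have : innerConfig a ω i = innerConfig a ω' i := hω _ fun v hv => by
        simp only [innerEdge, Sym2.mem_iff] at hv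
        rcases hv with rfl | rfl <;> exact ⟨_, by simp [edgeEnds], rfl⟩
      simp only [edgeInd, this]
    · intro ω ω' hω
      refine hf fun j hj => hω _ fun v hv => ?_
      simp only [innerEdge, Sym2.mem_iff] at hv
      obtain ⟨h2, h3⟩ := notMem_edgeEnds_of_mem_farEdges hj
      rcases hv with rfl | rfl
      exacts [⟨_, h2, rfl⟩, ⟨_, h3, rfl⟩]

/-- A fibre is internally connected with probability at least `0.04628`. -/
lemma le_integral_fibreInd (h : OneIndependent μ)
    (hp : ∀ e : (hypercube 6).edgeSet, 0.5847 ≤ μ.real {ω | ω e = true}) (a : Fin 8) :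
    0.04628 ≤ ∫ ω, fibreInd a ω ∂μ := by
  have h1 : lawFunctional μ 1 (innerConfig a) 1 = 1 := by simp [lawFunctional]
  have key := (isCubeModel_inner h a).mul_le_connInd_of_certValidAll (by norm_num) (by norm_num)
    (by norm_num) certValidAll₁ fun i => by
      have := hp (innerEdge a i)
      rw [← integral_edge_eq] at this
      rw [h1]
      simp only [lawFunctional, LinearMap.coe_mk, AddHom.coe_mk, Pi.one_apply, one_mul, edgeInd,
        innerConfig]
      norm_num at this ⊢
      exact this
  rw [h1] at key
  simp only [lawFunctional, LinearMap.coe_mk, AddHom.coe_mk, Pi.one_apply, one_mul] at key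
  norm_num at key ⊢
  exact key

lemma fibreInd_nonneg (a : Fin 8) (ω : BondConfig (hypercube 6)) : 0 ≤ fibreInd a ω :=
  connInd_nonneg _

lemma fibreInd_le_one (a : Fin 8) (ω : BondConfig (hypercube 6)) : fibreInd a ω ≤ 1 := by
  unfold fibreInd connInd; split_ifs <;> norm_num

/-- The states of the edges between two fibres are independent. -/
lemma integral_not_crossConfig_le (h : OneIndependent μ)
    (hp : ∀ e : (hypercube 6).edgeSet, 0.5847 ≤ μ.real {ω | ω e = true}) (i : Fin 12) :
    ∫ ω, (1 - edgeInd i (crossConfig ω)) ∂μ ≤ 0.4153 ^ 8 := by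
  have hprod : ∀ ω : BondConfig (hypercube 6), 1 - edgeInd i (crossConfig ω) =
      (∏ b : Fin 8, fun ω : BondConfig (hypercube 6) =>
        (1 - if ω (crossEdge i b) = true then (1 : ℝ) else 0)) ω := fun ω => by
    rw [Finset.prod_apply]
    by_cases hω : ∃ b, ω (crossEdge i b) = true
    · obtain ⟨b, hb⟩ := hω
      rw [Finset.prod_eq_zero (Finset.mem_univ b) (by simp [hb])]
      have : crossConfig ω i = true := by simpa [crossConfig] using ⟨b, hb⟩
      simp [edgeInd, this]
    · have : crossConfig ω i = false := by simpa [crossConfig] using hω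
      push Not at hω
      simp [edgeInd, this, hω]
  simp only [hprod]
  -- The parallel edges lie in distinct layers, one for each position `b`, and these layers are
  -- disjoint.
  rw [h.integral_prod (A := fun b => {x | ∃ a, cubePoint a b = x})]
  · refine (Finset.prod_le_prod (g := fun _ => 0.4153) (fun b _ => ?_) fun b _ => ?_).trans ?_
    · exact integral_nonneg fun ω => by split_ifs <;> norm_num
    · rw [integral_sub .of_finite .of_finite, integral_edge_eq]
      have := hp (crossEdge i b)
      simp only [integral_const, probReal_univ, one_smul]
      linarith
    · simp
  · intro b b' hb
    rw [Function.onFun, Set.disjoint_left]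
    rintro x ⟨a, rfl⟩ ⟨a', h'⟩
    exact hb (cubePoint_injective h').2.symm
  · intro b ω ω' hω
    have : ω (crossEdge i b) = ω' (crossEdge i b) := hω _ fun v hv => by
      simp only [crossEdge, Sym2.mem_iff] at hv
      rcases hv with rfl | rfl <;> exact ⟨_, rfl⟩
    simp only [this]

lemma integral_prod_fibreInd (h : OneIndependent μ) (s : Finset (Fin 8)) :
    ∫ ω, (∏ a ∈ s, fibreInd a) ω ∂μ = ∏ a ∈ s, ∫ ω, fibreInd a ω ∂μ :=
  h.integral_prod (A := fun a => fibres {a})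
    (fun _ _ hab => disjoint_fibres (Set.disjoint_singleton.2 hab))
    (fun a => dependsOn_fibreInd (Set.mem_singleton a)) s

lemma pow_le_integral_prod_fibreInd (h : OneIndependent μ)
    (hp : ∀ e : (hypercube 6).edgeSet, 0.5847 ≤ μ.real {ω | ω e = true}) (s : Finset (Fin 8)) :
    0.04628 ^ s.card ≤ ∫ ω, (∏ a ∈ s, fibreInd a) ω ∂μ := by
  rw [integral_prod_fibreInd h, ← Finset.prod_const]
  exact Finset.prod_le_prod (fun _ _ => by norm_num) fun a _ => le_integral_fibreInd h hp a

/-- Given that the fibres over the ends of `i` are connected, an event depending on these two fibres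
is independent of the other fibres. -/
lemma integral_split (h : OneIndependent μ) (i : Fin 12) {u f : (Fin 12 → Bool) → ℝ}
    (hu : DependsOn u {i}) (hf : DependsOn f (farEdges i)) :
    lawFunctional μ (∏ a, fibreInd a) crossConfig (u * f) =
      (∫ ω, (∏ a ∈ edgeEnds i, fibreInd a) ω * u (crossConfig ω) ∂μ) *
        ∫ ω, (∏ a ∈ (edgeEnds i)ᶜ, fibreInd a) ω * f (crossConfig ω) ∂μ := by
  have key := h.integral_mul (A := fibres (edgeEnds i)) (B := fibres (edgeEnds i)ᶜ)
    (F := (∏ a ∈ edgeEnds i, fibreInd a) * fun ω => u (crossConfig ω))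
    (H := (∏ a ∈ (edgeEnds i)ᶜ, fibreInd a) * fun ω => f (crossConfig ω))
    (disjoint_fibres disjoint_compl_right) ?_ ?_
  · refine Eq.trans (integral_congr_ae (.of_forall fun ω => ?_)) key
    simp only [Pi.mul_apply, ← Finset.prod_mul_prod_compl (edgeEnds i)]
    ring
  · refine .mul_real (.prod_real fun a ha => dependsOn_fibreInd ha) fun ω ω' hω => ?_
    refine hu fun j hj => ?_
    obtain rfl := hj
    exact crossConfig_congr hω (by simp [edgeEnds]) (by simp [edgeEnds])
  · refine .mul_real (.prod_real fun a ha => dependsOn_fibreInd (by simpa using ha))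
      fun ω ω' hω => ?_
    refine hf fun j hj => ?_
    obtain ⟨h1, h2⟩ := notMem_edgeEnds_of_mem_farEdges hj
    exact crossConfig_congr hω (by simpa using h1) (by simpa using h2)

lemma dependsOn_one {s : Set (Fin 12)} : DependsOn (1 : (Fin 12 → Bool) → ℝ) s := fun _ _ _ => rfl

lemma dependsOn_edgeInd (i : Fin 12) : DependsOn (edgeInd i) {i} := fun c c' h => by
  simp only [edgeInd, h i rfl]

/-- The weight is a product over fibres, so by `integral_split` each of the four expectations is a
factor from the two fibres at the ends of `i` times a factor from the other six. The two sides are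
then the same product. Leaving the functional unnormalised avoids conditional measures. -/
lemma isCubeModel_cross (h : OneIndependent μ)
    (hp : ∀ e : (hypercube 6).edgeSet, 0.5847 ≤ μ.real {ω | ω e = true}) :
    IsCubeModel (lawFunctional μ (∏ a, fibreInd a) crossConfig) where
  nonneg f hf := integral_nonneg fun ω => by
    rw [Finset.prod_apply]
    exact mul_nonneg (Finset.prod_nonneg fun a _ => fibreInd_nonneg a ω) (hf _)
  pos := by
    have := pow_le_integral_prod_fibreInd h hp Finset.univ
    simp only [lawFunctional, LinearMap.coe_mk, AddHom.coe_mk, Pi.one_apply, mul_one]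
    exact lt_of_lt_of_le (by positivity) this
  indep i f hf := by
    have h1 := integral_split h i (dependsOn_edgeInd i) hf
    have h2 := integral_split h i dependsOn_one hf
    have h3 := integral_split h i (dependsOn_edgeInd i) dependsOn_one
    have h4 := integral_split h i dependsOn_one dependsOn_one
    rw [one_mul] at h2 h4
    rw [mul_one] at h3
    rw [h1, h2, h3, h4]
    ring

/-- The factor from the six other fibres is common to both sides and cancels, leaving a bound that
involves only the two fibres at the ends of `i`. -/
lemma le_crossConfig (h : OneIndependent μ)
    (hp : ∀ e : (hypercube 6).edgeSet, 0.5847 ≤ μ.real {ω | ω e = true}) (i : Fin 12) :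
    0.5868 * lawFunctional μ (∏ a, fibreInd a) crossConfig 1 ≤
      lawFunctional μ (∏ a, fibreInd a) crossConfig (edgeInd i) := by
  have h3 := integral_split h i (dependsOn_edgeInd i) dependsOn_one
  have h4 := integral_split h i dependsOn_one dependsOn_one
  rw [one_mul] at h4
  rw [mul_one] at h3
  rw [h3, h4, ← mul_assoc]
  have hnn : ∀ (s : Finset (Fin 8)) ω, 0 ≤ (∏ a ∈ s, fibreInd a) ω := fun s ω => by
    rw [Finset.prod_apply]; exact Finset.prod_nonneg fun a _ => fibreInd_nonneg a ω
  have hle : ∀ (s : Finset (Fin 8)) ω, (∏ a ∈ s, fibreInd a) ω ≤ 1 := fun s ω => by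
    rw [Finset.prod_apply]
    exact Finset.prod_le_one (fun a _ => fibreInd_nonneg a ω) fun a _ => fibreInd_le_one a ω
  refine mul_le_mul_of_nonneg_right ?_ (integral_nonneg fun ω => by simpa using hnn _ ω)
  have hcard : ∀ i, (edgeEnds i).card = 2 := by decide
  have h5 := pow_le_integral_prod_fibreInd h hp (edgeEnds i)
  rw [hcard] at h5
  have h6 := integral_not_crossConfig_le h hp i
  -- Union bound: the weight is at most `1`, so closing edge `i` loses at most the probability of
  -- that closure.
  have h7 : ∫ ω, (∏ a ∈ edgeEnds i, fibreInd a) ω ∂μ - ∫ ω, (1 - edgeInd i (crossConfig ω)) ∂μ ≤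
      ∫ ω, (∏ a ∈ edgeEnds i, fibreInd a) ω * edgeInd i (crossConfig ω) ∂μ := by
    rw [← integral_sub .of_finite .of_finite]
    refine integral_mono .of_finite .of_finite fun ω => ?_
    have := hle (edgeEnds i) ω
    simp only [edgeInd]
    split_ifs <;> linarith
  simp only [Pi.one_apply, mul_one, Finset.prod_apply] at h5 h6 h7 ⊢
  norm_num at h5 h6 ⊢
  -- The numbers fit because `0.4153 ^ 8 ≤ (1 - 0.5868) * 0.04628 ^ 2`.
  linarith

end Model

/-! ### From the two cube models to `Q_6`. -/

/-- If all fibres are internally connected and the fibres are connected with each other, then so is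
the whole configuration. -/
lemma connected_of_fibres {ω : BondConfig (hypercube 6)}
    (hin : ∀ a, (cubeGraph (innerConfig a ω)).Connected)
    (hout : (cubeGraph (crossConfig ω)).Connected) : (openSubgraph ω).Connected := by
  have hadj : ∀ x y (h : (hypercube 6).Adj x y), ω ⟨s(x, y), h⟩ = true →
      (openSubgraph ω).Adj x y := fun x y h hω => by
    rw [openSubgraph, SimpleGraph.fromEdgeSet_adj]
    exact ⟨⟨h, hω⟩, h.ne⟩
  have h1 : ∀ a b b', (openSubgraph ω).Reachable (cubePoint a b) (cubePoint a b') := fun a b b' => by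
    let φ : cubeGraph (innerConfig a ω) →g openSubgraph ω :=
      ⟨cubePoint a, fun {u v} huv => by
        rw [cubeGraph, SimpleGraph.fromRel_adj] at huv
        rcases huv with ⟨_, ⟨i, hi, he⟩ | ⟨i, hi, he⟩⟩
        · have := hadj _ _ (hypercube_adj_inner a i) hi
          rwa [he] at this
        · have := (hadj _ _ (hypercube_adj_inner a i) hi).symm
          rwa [he] at this⟩
    exact ((hin a).preconnected b b').map φ
  have h2 : ∀ a a', (cubeGraph (crossConfig ω)).Adj a a' →
      (openSubgraph ω).Reachable (cubePoint a 0) (cubePoint a' 0) := by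
    have h3 : ∀ i, crossConfig ω i = true → (openSubgraph ω).Reachable
        (cubePoint (cubeEdge i).1 0) (cubePoint (cubeEdge i).2 0) := fun i hi => by
      obtain ⟨b, hb⟩ := of_decide_eq_true hi
      exact ((h1 _ 0 b).trans (hadj _ _ (hypercube_adj_cross i b) hb).reachable).trans (h1 _ b 0)
    intro a a' haa'
    rw [cubeGraph, SimpleGraph.fromRel_adj] at haa'
    rcases haa' with ⟨_, ⟨i, hi, he⟩ | ⟨i, hi, he⟩⟩
    · have := h3 i hi
      rwa [he] at this
    · have := (h3 i hi).symm
      rwa [he] at this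
  have h4 : ∀ a a', (openSubgraph ω).Reachable (cubePoint a 0) (cubePoint a' 0) := fun a a' => by
    obtain ⟨p⟩ := hout.preconnected a a'
    induction p with
    | nil => exact .refl _
    | cons h _ ih => exact (h2 _ _ h).trans ih
  refine ⟨fun x y => ?_⟩
  obtain ⟨a, b, rfl⟩ := cubePoint_surjective x
  obtain ⟨a', b', rfl⟩ := cubePoint_surjective y
  exact ((h1 a b 0).trans (h4 a a')).trans (h1 a' 0 b')

theorem lemma1p5 :
    ∃ P : ℝ, (1 - 0.5847) ^ 32 * Real.goldenRatio < P ∧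
      ∀ μ ∈ oneIndepModels (hypercube 6) 0.5847,
        P ≤ μ.real {ω | (openSubgraph ω).Connected} := by
  -- The outer cube contributes `0.0475` and the eight independent fibres `0.04628 ^ 8`. The product
  -- exceeds the target by less than one percent, so the certificates have little slack.
  refine ⟨0.0475 * 0.04628 ^ 8, ?_, ?_⟩
  · have h5 : Real.sqrt 5 < 2.2361 := by
      rw [Real.sqrt_lt' (by norm_num)]; norm_num
    have h6 : Real.goldenRatio < 1.61805 := by
      rw [Real.goldenRatio]; linarith
    refine (mul_lt_mul_of_pos_left h6 (by positivity)).trans ?_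
    norm_num
  · rintro μ ⟨hμ, h, hp⟩
    have h1 := pow_le_integral_prod_fibreInd h hp Finset.univ
    have h2 := (isCubeModel_cross h hp).mul_le_connInd_of_certValidAll (by norm_num) (by norm_num)
      (by norm_num) certValidAll₂ fun i => by
        have := le_crossConfig h hp i
        norm_num at this ⊢
        exact this
    have h3 : lawFunctional μ (∏ a, fibreInd a) crossConfig connInd ≤
        μ.real {ω | (openSubgraph ω).Connected} := by
      classical
      rw [← integral_indicator_one (MeasurableSet.of_discrete)]
      -- Pointwise, the product of the fibre and outer indicators is at most the indicator that the
      -- whole configuration is connected.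
      refine integral_mono .of_finite .of_finite fun ω => ?_
      simp only [Finset.prod_apply]
      by_cases hω : (openSubgraph ω).Connected
      · rw [Set.indicator_of_mem (by exact hω), Pi.one_apply]
        refine mul_le_one₀ (Finset.prod_le_one (fun a _ => fibreInd_nonneg a ω)
          fun a _ => fibreInd_le_one a ω) (connInd_nonneg _) ?_
        unfold connInd; split_ifs <;> norm_num
      · rw [Set.indicator_of_notMem (by exact hω)]
        by_cases hout : (cubeGraph (crossConfig ω)).Connected
        · obtain ⟨a, ha⟩ : ∃ a, ¬(cubeGraph (innerConfig a ω)).Connected := by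
            by_contra! hin
            exact hω (connected_of_fibres hin hout)
          rw [Finset.prod_eq_zero (Finset.mem_univ a) (by simp [fibreInd, connInd, ha]), zero_mul]
        · simp [connInd, hout]
    simp only [lawFunctional, LinearMap.coe_mk, AddHom.coe_mk, Pi.one_apply, mul_one] at h2 h3
    refine le_trans ?_ (h2.trans h3)
    norm_num at h1 ⊢
    linarith
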